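/- For a (strict) 2-category $\mathcal A$, let $\mathcal A^{\mathrm{co}}$ denote $\mathcal A$ with its 2-cells (but not its 1-cells) reversed. A *strong duality involution* on $\mathcal A$ consists of a strict 2-functor $(-)^\circ : \mathcal A^{\mathrm{co}} \to \mathcal A$ and a strict 2-natural isomorphism $\mathfrak y : 1_{\mathcal A} \cong (-)^{\circ\circ}$ (where $(-)^{\circ\circ}$ is the composite of $((-)^\circ)^{\mathrm{co}} : \mathcal A \to \mathcal A^{\mathrm{co}}$ and $(-)^\circ$) such that $\mathfrak y_{x^\circ} = (\mathfrak y_x)^\circ$ for every object $x$. It is *strict* if $\mathfrak y$ is an identity. A *duality 2-functor* $\mathcal A \to \mathcal B$ between 2-categories with strong duality involutions is a strict 2-functor $F : \mathcal A \to \mathcal B$ equipped with a strict 2-natural isomorphism $\mathfrak i$ with components $\mathfrak i_x : (Fx)^\circ \to F(x^\circ)$ such that $\mathfrak i_{x^\circ} \circ (\mathfrak i_x)^\circ \circ \mathfrak y_{Fx} = F(\mathfrak y_x)$ for every object $x$ of $\mathcal A$. A 2-functor $F : \mathcal A \to \mathcal B$ is a *2-equivalence* if there are a 2-functor $G : \mathcal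 B \to \mathcal A$ and strict 2-natural isomorphisms $1_{\mathcal A} \cong GF$ and $FG \cong 1_{\mathcal B}$. **Theorem.** If $\mathcal A$ is a 2-category with a strong duality involution, then there is a 2-category $\mathcal A'$ with a strict duality involution and a duality 2-functor $\mathcal A \to \mathcal A'$ that is a 2-equivalence. -/

import Mathlib

open CategoryTheory Bicategory Opposite

universe w₁ w₂ w v₁ v₂ v u₁ u₂ u

namespace TwoDuality

/-!
A 2-category is a bicategory `A` with `[Bicategory.Strict A]`, and a (strict) 2-functor between
2-categories is a `StrictPseudofunctor`.
-/

/-- The dual `A^co` of `A`, which has the 2-cells reversed but not the 1-cells: it has the same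
objects and the same 1-cells as `A`, and a 2-cell `f ⟶ g` of `A^co` is a 2-cell `g ⟶ f` of `A`. -/
@[ext]
structure Co (A : Type u) where
  /-- the underlying object of `A` -/
  as : A

namespace Co

section

variable {A : Type u} [Bicategory.{w, v} A]

/-- The 1-cells of `A^co`. -/
@[ext]
structure Hom₁ (a b : Co A) where
  /-- the underlying 1-cell of `A` -/
  as : a.as ⟶ b.as

instance : CategoryStruct.{v} (Co A) where
  Hom a b := Hom₁ a b
  id a := ⟨𝟙 a.as⟩
  comp f g := ⟨f.as ≫ g.as⟩

@[simp] lemma id₁_as (a : Co A) : (𝟙 a : a ⟶ a).as = 𝟙 a.as := rfl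

@[simp] lemma comp₁_as {a b c : Co A} (f : a ⟶ b) (g : b ⟶ c) :
    (f ≫ g).as = f.as ≫ g.as := rfl

/-- The 2-cells of `A^co`. -/
@[ext]
structure Hom₂ {a b : Co A} (f g : a ⟶ b) where
  /-- the underlying 2-cell of `A`, in the opposite direction -/
  as : g.as ⟶ f.as

instance (a b : Co A) : Category.{w} (a ⟶ b) where
  Hom f g := Hom₂ f g
  id f := ⟨𝟙 f.as⟩
  comp η θ := ⟨θ.as ≫ η.as⟩

@[simp] lemma id₂_as {a b : Co A} (f : a ⟶ b) : (𝟙 f : f ⟶ f).as = 𝟙 f.as := rfl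

@[simp] lemma comp₂_as {a b : Co A} {f g h : a ⟶ b} (η : f ⟶ g) (θ : g ⟶ h) :
    (η ≫ θ).as = θ.as ≫ η.as := rfl

@[ext] lemma hom₁_ext {a b : Co A} {f g : a ⟶ b} (h : f.as = g.as) : f = g :=
  Hom₁.ext h

@[ext] lemma hom₂_ext {a b : Co A} {f g : a ⟶ b} {η θ : f ⟶ g} (h : η.as = θ.as) : η = θ :=
  Hom₂.ext h

/-- An isomorphism `f ≅ g` of `A` (with inverse `g ≅ f`), as an isomorphism `f ≅ g` of `A^co`. -/
@[simps]
def mkIso {a b : Co A} {f g : a ⟶ b} (e : f.as ≅ g.as) : f ≅ g where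
  hom := ⟨e.inv⟩
  inv := ⟨e.hom⟩

@[simp] lemma eqToHom_as {a b : Co A} {f g : a ⟶ b} (h : f = g) :
    (eqToHom h).as = eqToHom (congrArg Hom₁.as h.symm) := by
  subst h; rfl

instance : Bicategory.{w, v} (Co A) where
  homCategory a b := inferInstance
  whiskerLeft f _ _ η := ⟨f.as ◁ η.as⟩
  whiskerRight η h := ⟨η.as ▷ h.as⟩
  associator f g h := mkIso (α_ f.as g.as h.as)
  leftUnitor f := mkIso (λ_ f.as)
  rightUnitor f := mkIso (ρ_ f.as)
  whisker_exchange η θ := by ext; simp [whisker_exchange]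

@[simp] lemma whiskerLeft_as {a b c : Co A} (f : a ⟶ b) {g h : b ⟶ c} (η : g ⟶ h) :
    (f ◁ η).as = f.as ◁ η.as := rfl

@[simp] lemma whiskerRight_as {a b c : Co A} {f g : a ⟶ b} (η : f ⟶ g) (h : b ⟶ c) :
    (η ▷ h).as = η.as ▷ h.as := rfl

@[simp] lemma associator_eq {a b c d : Co A} (f : a ⟶ b) (g : b ⟶ c) (h : c ⟶ d) :
    α_ f g h = mkIso (α_ f.as g.as h.as) := rfl

@[simp] lemma leftUnitor_eq {a b : Co A} (f : a ⟶ b) : λ_ f = mkIso (λ_ f.as) := rfl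

@[simp] lemma rightUnitor_eq {a b : Co A} (f : a ⟶ b) : ρ_ f = mkIso (ρ_ f.as) := rfl

instance [Bicategory.Strict A] : Bicategory.Strict (Co A) where
  id_comp f := by ext; simp
  comp_id f := by ext; simp
  assoc f g h := by ext; simp
  leftUnitor_eqToIso f := by ext; simp [Bicategory.Strict.leftUnitor_eqToIso]
  rightUnitor_eqToIso f := by ext; simp [Bicategory.Strict.rightUnitor_eqToIso]
  associator_eqToIso f g h := by ext; simp [Bicategory.Strict.associator_eqToIso]

end

section

variable {A : Type u₁} [Bicategory.{w₁, v₁} A] [Bicategory.Strict A]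
  {B : Type u₂} [Bicategory.{w₂, v₂} B] [Bicategory.Strict B]

/-- The 2-functor `F^co : A^co ⟶ B^co` given by a 2-functor `F : A ⟶ B`. -/
def map (F : StrictPseudofunctor A B) : StrictPseudofunctor (Co A) (Co B) :=
  StrictPseudofunctor.mk''
    { obj := fun a => ⟨F.obj a.as⟩
      map := fun f => ⟨F.map f.as⟩
      map₂ := fun η => ⟨F.map₂ η.as⟩
      map_id := fun _ => by ext; simp [F.map_id]
      map_comp := fun _ _ => by ext; simp [F.map_comp]
      map₂_whisker_left := fun _ _ _ _ => by
        ext; simp [F.map₂_whisker_left, F.mapComp_eq_eqToIso]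
      map₂_whisker_right := fun _ _ => by
        ext; simp [F.map₂_whisker_right, F.mapComp_eq_eqToIso] }

variable (A) in
/-- The identification of `A` with `(A^co)^co`. -/
def double : StrictPseudofunctor A (Co (Co A)) :=
  StrictPseudofunctor.mk''
    { obj := fun a => ⟨⟨a⟩⟩
      map := fun f => ⟨⟨f⟩⟩
      map₂ := fun η => ⟨⟨η⟩⟩ }

end

end Co

section

variable {A : Type u₁} [Bicategory.{w₁, v₁} A] [Bicategory.Strict A]
  {B : Type u₂} [Bicategory.{w₂, v₂} B] [Bicategory.Strict B]

/-- A strict 2-natural transformation `F ⟶ G` between 2-functors: a family of 1-cells that is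
strictly natural with respect to both 1-cells and 2-cells. -/
structure TwoNatTrans (F G : StrictPseudofunctor A B) where
  /-- the component at an object -/
  app (x : A) : F.obj x ⟶ G.obj x
  naturality {x y : A} (f : x ⟶ y) : F.map f ≫ app y = app x ≫ G.map f
  naturality₂ {x y : A} {f g : x ⟶ y} (η : f ⟶ g) :
    F.map₂ η ▷ app y ≫ eqToHom (naturality g) =
      eqToHom (naturality f) ≫ app x ◁ G.map₂ η

/-- A strict 2-natural isomorphism between 2-functors. -/
structure TwoNatIso (F G : StrictPseudofunctor A B) where
  /-- the underlying transformation -/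
  hom : TwoNatTrans F G
  /-- its strict inverse -/
  inv : TwoNatTrans G F
  hom_inv_id (x : A) : hom.app x ≫ inv.app x = 𝟙 (F.obj x)
  inv_hom_id (x : A) : inv.app x ≫ hom.app x = 𝟙 (G.obj x)

/-- A 2-functor `F : A ⟶ B` is a 2-equivalence if there are a 2-functor `G : B ⟶ A` and strict
2-natural isomorphisms `1 ≅ GF` and `FG ≅ 1`. -/
def IsTwoEquivalence (F : StrictPseudofunctor A B) : Prop :=
  ∃ G : StrictPseudofunctor B A,
    Nonempty (TwoNatIso (StrictPseudofunctor.id A) (F.comp G)) ∧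
      Nonempty (TwoNatIso (G.comp F) (StrictPseudofunctor.id B))

end

/-- The composite 2-functor `A ⟶ A^co ⟶ A`, `x ↦ x°°`, of `((-)°)^co` and `(-)°`, for a
2-functor `(-)° : A^co ⟶ A`. -/
def twice {A : Type u} [Bicategory.{w, v} A] [Bicategory.Strict A]
    (D : StrictPseudofunctor (Co A) A) : StrictPseudofunctor A A :=
  ((Co.double A).comp (Co.map D)).comp D

/-- A strong duality involution on a 2-category `A`: a 2-functor `(-)° : A^co ⟶ A` and a strict
2-natural isomorphism `𝔶 : 1 ≅ (-)°°` such that `𝔶` at `x°` equals `(𝔶 at x)°`, that is, such that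
the modification `ζ` with components `𝔶_{x°} ≅ (𝔶_x)°` is an identity. (The further axiom
on `ζ` compares two pasting composites of identity 2-cells and so holds automatically.) -/
structure StrongDualityInvolution (A : Type u) [Bicategory.{w, v} A] [Bicategory.Strict A] where
  /-- the 2-functor `(-)°` -/
  functor : StrictPseudofunctor (Co A) A
  /-- the 2-natural isomorphism `𝔶` -/
  unit : TwoNatIso (StrictPseudofunctor.id A) (twice functor)
  unit_dual (x : A) :
    unit.hom.app (functor.obj ⟨x⟩) = functor.map ⟨unit.hom.app x⟩

namespace StrongDualityInvolution

section

variable {A : Type u} [Bicategory.{w, v} A] [Bicategory.Strict A]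

/-- The dual object `x°`. -/
def dual (D : StrongDualityInvolution A) (x : A) : A := D.functor.obj ⟨x⟩

/-- The dual 1-cell `f° : x° ⟶ y°` of `f : x ⟶ y`. -/
def dualMap (D : StrongDualityInvolution A) {x y : A} (f : x ⟶ y) : D.dual x ⟶ D.dual y :=
  D.functor.map ⟨f⟩

/-- The component `𝔶_x : x ⟶ x°°`. -/
def unitApp (D : StrongDualityInvolution A) (x : A) : x ⟶ D.dual (D.dual x) := D.unit.hom.app x

/-- A strong duality involution is strict if `𝔶` is an identity: `x°° = x` for all objects `x`,
and along this equality the component of `𝔶` at `x` is the identity 1-cell. (By naturality of `𝔶`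
the equality `(-)°° = 1` then holds on 1-cells and 2-cells too.) -/
def IsStrict (D : StrongDualityInvolution A) : Prop :=
  ∀ x : A, ∃ h : x = D.dual (D.dual x), D.unitApp x = eqToHom h

end

end StrongDualityInvolution

/-- A (strong) duality 2-functor between 2-categories with strong duality involutions: a 2-functor
`F : A ⟶ B` with a strict 2-natural isomorphism `𝔦` from `(-)° ∘ F^co` to `F ∘ (-)°`, with
components `(F x)° ⟶ F (x°)`, such that the composite
`F x ⟶ (F x)°° ⟶ (F (x°))° ⟶ F (x°°)` of `𝔶`, `(𝔦_x)°` and `𝔦_{x°}` is equal to `F (𝔶_x)`, that is,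
such that the modification `θ` is an identity. (The further axiom on `θ` compares two pasting
composites of identity 2-cells and so holds automatically.) -/
structure DualityTwoFunctor
    {A : Type u₁} [Bicategory.{w₁, v₁} A] [Bicategory.Strict A]
    {B : Type u₂} [Bicategory.{w₂, v₂} B] [Bicategory.Strict B]
    (D : StrongDualityInvolution A) (E : StrongDualityInvolution B) where
  /-- the underlying 2-functor -/
  functor : StrictPseudofunctor A B
  /-- the comparison 2-natural isomorphism -/
  comparison : TwoNatIso ((Co.map functor).comp E.functor) (D.functor.comp functor)
  comparison_unit (x : A) :
    E.unitApp (functor.obj x) ≫ E.dualMap (comparison.hom.app ⟨x⟩) ≫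
        comparison.hom.app ⟨D.dual x⟩ =
      functor.map (D.unitApp x)

end TwoDuality

open TwoDuality

/-! Duality becomes strict once every cell carries its dual along. Each object `x` of `A` gets a
positive copy, standing for `x`, and a negative copy, standing for `x°`. A cell of the new
2-category is a pair: a cell between the objects stood for, and one between those that the formal
duals stand for. The two are matched through `toDual`, which is `𝔶` at positive objects and an
identity at negative ones. Duality swaps the two entries, so doing it twice changes nothing.

Since `toDual` is invertible, each entry determines the other, and projecting to the first entry
loses nothing. Projection undoes the inclusion `x ↦ (x, +)`, and the other composite is isomorphic
to the identity through `toPos`. The consistency of the two matchings is `toDual_dualMap`: composed,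
they give `𝔶`. At negative objects this is exactly the axiom `𝔶_{x°} = (𝔶_x)°`. -/

namespace TwoDuality

/-! ### Heterogeneous equality of 2-cells in strict bicategories -/

section HEqCalculus

variable {B : Type u} [Bicategory.{w, v} B]

/-- Strict unit and associativity laws are only propositional, so equations of 2-cells carry
`eqToHom` factors. Passing to `≍` absorbs these factors, and equations can then be chained freely.
-/
lemma comp_eqToHom_eq_iff_heq {C : Type*} [Category C] {f f' g g' : C} {α : f ⟶ g}
    {β : f' ⟶ g'} (hf : f = f') (hg : g = g') :
    α ≫ eqToHom hg = eqToHom hf ≫ β ↔ α ≍ β := by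
  subst hf hg; simp

lemma eq_eqToHom_comp_of_heq {C : Type*} [Category C] {f f' g g' : C} {α : f ⟶ g}
    {β : f' ⟶ g'} (hf : f = f') (hg : g = g') (h : α ≍ β) :
    α = eqToHom hf ≫ β ≫ eqToHom hg.symm := by
  subst hf hg h; simp

lemma comp_heq_comp {C : Type*} [Category C] {f f' g g' h h' : C}
    {α : f ⟶ g} {β : g ⟶ h} {α' : f' ⟶ g'} {β' : g' ⟶ h'}
    (hf : f = f') (hg : g = g') (hh : h = h') (hα : α ≍ α') (hβ : β ≍ β') :
    α ≫ β ≍ α' ≫ β' := by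
  subst hf hg hh hα hβ; rfl

lemma whiskerLeft_heq_whiskerLeft {a b c : B} {f f' : a ⟶ b} {g g' h h' : b ⟶ c}
    {η : g ⟶ h} {η' : g' ⟶ h'} (hf : f = f') (hg : g = g') (hh : h = h') (hη : η ≍ η') :
    f ◁ η ≍ f' ◁ η' := by
  subst hf hg hh hη; rfl

lemma whiskerRight_heq_whiskerRight {a b c : B} {f f' g g' : a ⟶ b} {h h' : b ⟶ c}
    {η : f ⟶ g} {η' : f' ⟶ g'} (hf : f = f') (hg : g = g') (hh : h = h') (hη : η ≍ η') :
    η ▷ h ≍ η' ▷ h' := by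
  subst hf hg hh hη; rfl

variable [Bicategory.Strict B]

lemma id_whiskerLeft_heq {a b : B} {f g : a ⟶ b} (η : f ⟶ g) : 𝟙 a ◁ η ≍ η := by
  rw [← comp_eqToHom_eq_iff_heq (Bicategory.Strict.id_comp f) (Bicategory.Strict.id_comp g)]
  simp [Bicategory.Strict.leftUnitor_eqToIso]

lemma whiskerRight_id_heq {a b : B} {f g : a ⟶ b} (η : f ⟶ g) : η ▷ 𝟙 b ≍ η := by
  rw [← comp_eqToHom_eq_iff_heq (Bicategory.Strict.comp_id f) (Bicategory.Strict.comp_id g)]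
  simp [Bicategory.Strict.rightUnitor_eqToIso]

lemma comp_whiskerLeft_heq {a b c d : B} (f : a ⟶ b) (g : b ⟶ c) {h h' : c ⟶ d} (η : h ⟶ h') :
    (f ≫ g) ◁ η ≍ f ◁ g ◁ η := by
  rw [← comp_eqToHom_eq_iff_heq (Bicategory.Strict.assoc f g h) (Bicategory.Strict.assoc f g h')]
  simp [Bicategory.Strict.associator_eqToIso]

lemma whiskerRight_comp_heq {a b c d : B} {f f' : a ⟶ b} (η : f ⟶ f') (g : b ⟶ c) (h : c ⟶ d) :
    η ▷ (g ≫ h) ≍ η ▷ g ▷ h := by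
  rw [← comp_eqToHom_eq_iff_heq (Bicategory.Strict.assoc f g h).symm
    (Bicategory.Strict.assoc f' g h).symm]
  simp [Bicategory.Strict.associator_eqToIso]

lemma whisker_assoc_heq {a b c d : B} (f : a ⟶ b) {g g' : b ⟶ c} (η : g ⟶ g') (h : c ⟶ d) :
    (f ◁ η) ▷ h ≍ f ◁ η ▷ h := by
  rw [← comp_eqToHom_eq_iff_heq (Bicategory.Strict.assoc f g h) (Bicategory.Strict.assoc f g' h)]
  simp [Bicategory.Strict.associator_eqToIso]

variable {C : Type u₁} [Bicategory.{w₁, v₁} C]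

lemma map₂_whiskerLeft_heq (F : StrictPseudofunctor B C) {a b c : B} (f : a ⟶ b)
    {g g' : b ⟶ c} (η : g ⟶ g') : F.map₂ (f ◁ η) ≍ F.map f ◁ F.map₂ η := by
  rw [← comp_eqToHom_eq_iff_heq (F.map_comp f g) (F.map_comp f g')]
  simp [F.map₂_whisker_left, F.mapComp_eq_eqToIso]

lemma map₂_whiskerRight_heq (F : StrictPseudofunctor B C) {a b c : B} {f f' : a ⟶ b}
    (η : f ⟶ f') (g : b ⟶ c) : F.map₂ (η ▷ g) ≍ F.map₂ η ▷ F.map g := by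
  rw [← comp_eqToHom_eq_iff_heq (F.map_comp f g) (F.map_comp f' g)]
  simp [F.map₂_whisker_right, F.mapComp_eq_eqToIso]

end HEqCalculus

/-! ### Constructors for strict 2-natural isomorphisms -/

section TwoNat

variable {A : Type u₁} [Bicategory.{w₁, v₁} A] [Bicategory.Strict A]
  {B : Type u₂} [Bicategory.{w₂, v₂} B] [Bicategory.Strict B] {F G : StrictPseudofunctor A B}

lemma TwoNatTrans.naturality₂_heq (t : TwoNatTrans F G) {x y : A} {f g : x ⟶ y} (η : f ⟶ g) :
    F.map₂ η ▷ t.app y ≍ t.app x ◁ G.map₂ η :=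
  (comp_eqToHom_eq_iff_heq _ _).1 (t.naturality₂ η)

/-- A strict 2-natural transformation, with naturality on 2-cells given as a heterogeneous
equality. -/
@[simps]
def TwoNatTrans.ofHEq (app : ∀ x, F.obj x ⟶ G.obj x)
    (naturality : ∀ {x y : A} (f : x ⟶ y), F.map f ≫ app y = app x ≫ G.map f)
    (naturality₂ : ∀ {x y : A} {f g : x ⟶ y} (η : f ⟶ g),
      F.map₂ η ▷ app y ≍ app x ◁ G.map₂ η) : TwoNatTrans F G where
  app := app
  naturality := naturality
  naturality₂ η := (comp_eqToHom_eq_iff_heq _ _).2 (naturality₂ η)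

/-- A strict 2-natural transformation with strictly invertible components is a strict 2-natural
isomorphism. -/
def TwoNatIso.ofComponents (hom : TwoNatTrans F G) (inv : ∀ x, G.obj x ⟶ F.obj x)
    (hom_inv : ∀ x, hom.app x ≫ inv x = 𝟙 (F.obj x))
    (inv_hom : ∀ x, inv x ≫ hom.app x = 𝟙 (G.obj x)) : TwoNatIso F G where
  hom := hom
  inv :=
    have nat {x y : A} (f : x ⟶ y) : G.map f ≫ inv y = inv x ≫ F.map f := by
      rw [← Category.id_comp (G.map f), ← inv_hom x, Category.assoc (inv x), ← hom.naturality f,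
        Category.assoc, Category.assoc, hom_inv, Category.comp_id]
    TwoNatTrans.ofHEq inv nat fun {x y f g} η => by
      -- Insert `inv x ≫ hom.app x` on the left, move `hom` across by its own naturality, then
      -- cancel `hom.app y ≫ inv y`.
      have h₁ : G.map₂ η ▷ inv y ≍ (inv x ≫ hom.app x) ◁ G.map₂ η ▷ inv y := by
        rw [inv_hom]; exact (id_whiskerLeft_heq _).symm
      have h₂ : hom.app x ◁ G.map₂ η ▷ inv y ≍ F.map₂ η ▷ hom.app y ▷ inv y :=
        (whisker_assoc_heq _ _ _).symm.trans (whiskerRight_heq_whiskerRight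
          (hom.naturality f).symm (hom.naturality g).symm rfl (hom.naturality₂_heq η).symm)
      have h₃ : F.map₂ η ▷ hom.app y ▷ inv y ≍ F.map₂ η := by
        refine (whiskerRight_comp_heq _ _ _).symm.trans ?_
        rw [hom_inv]; exact whiskerRight_id_heq _
      have e (k : x ⟶ y) : hom.app x ≫ G.map k ≫ inv y = F.map k := by
        rw [nat, ← Category.assoc, hom_inv, Category.id_comp]
      exact h₁.trans ((comp_whiskerLeft_heq _ _ _).trans
        (whiskerLeft_heq_whiskerLeft rfl (e f) (e g) (h₂.trans h₃)))
  hom_inv_id := hom_inv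
  inv_hom_id := inv_hom

/-- The inverse of a strict 2-natural isomorphism. -/
def TwoNatIso.symm (t : TwoNatIso F G) : TwoNatIso G F where
  hom := t.inv
  inv := t.hom
  hom_inv_id := t.inv_hom_id
  inv_hom_id := t.hom_inv_id

end TwoNat

/-! ### Duality of cells without the wrappers of `Co`. -/

namespace StrongDualityInvolution

variable {A : Type u} [Bicategory.{w, v} A] [Bicategory.Strict A] (D : StrongDualityInvolution A)

/-- The dual 2-cell `η° : g° ⟶ f°` of `η : f ⟶ g`. -/
def dualMap₂ {x y : A} {f g : x ⟶ y} (η : f ⟶ g) : D.dualMap g ⟶ D.dualMap f :=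
  D.functor.map₂ (a := ⟨x⟩) (b := ⟨y⟩) (f := ⟨g⟩) (g := ⟨f⟩) ⟨η⟩

@[simp] lemma dualMap_id (x : A) : D.dualMap (𝟙 x) = 𝟙 (D.dual x) := D.functor.map_id ⟨x⟩

@[simp] lemma dualMap_comp {x y z : A} (f : x ⟶ y) (g : y ⟶ z) :
    D.dualMap (f ≫ g) = D.dualMap f ≫ D.dualMap g :=
  D.functor.map_comp (a := ⟨x⟩) (b := ⟨y⟩) (c := ⟨z⟩) ⟨f⟩ ⟨g⟩

@[simp] lemma dualMap₂_id {x y : A} (f : x ⟶ y) : D.dualMap₂ (𝟙 f) = 𝟙 (D.dualMap f) :=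
  D.functor.map₂_id _

@[simp] lemma dualMap₂_comp {x y : A} {f g h : x ⟶ y} (η : f ⟶ g) (θ : g ⟶ h) :
    D.dualMap₂ (η ≫ θ) = D.dualMap₂ θ ≫ D.dualMap₂ η :=
  D.functor.map₂_comp (a := ⟨x⟩) (b := ⟨y⟩) (f := ⟨h⟩) (g := ⟨g⟩) (h := ⟨f⟩) ⟨θ⟩ ⟨η⟩

lemma dualMap₂_whiskerLeft_heq {x y z : A} (f : x ⟶ y) {g h : y ⟶ z} (η : g ⟶ h) :
    D.dualMap₂ (f ◁ η) ≍ D.dualMap f ◁ D.dualMap₂ η :=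
  map₂_whiskerLeft_heq D.functor (a := ⟨x⟩) (b := ⟨y⟩) (c := ⟨z⟩) ⟨f⟩ (g := ⟨h⟩) (g' := ⟨g⟩) ⟨η⟩

lemma dualMap₂_whiskerRight_heq {x y z : A} {f g : x ⟶ y} (η : f ⟶ g) (h : y ⟶ z) :
    D.dualMap₂ (η ▷ h) ≍ D.dualMap₂ η ▷ D.dualMap h :=
  map₂_whiskerRight_heq D.functor (a := ⟨x⟩) (b := ⟨y⟩) (c := ⟨z⟩) (f := ⟨g⟩) (f' := ⟨f⟩) ⟨η⟩ ⟨h⟩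

lemma unitApp_naturality {x y : A} (f : x ⟶ y) :
    f ≫ D.unitApp y = D.unitApp x ≫ D.dualMap (D.dualMap f) :=
  D.unit.hom.naturality f

lemma unitApp_naturality₂_heq {x y : A} {f g : x ⟶ y} (η : f ⟶ g) :
    η ▷ D.unitApp y ≍ D.unitApp x ◁ D.dualMap₂ (D.dualMap₂ η) :=
  D.unit.hom.naturality₂_heq η

lemma unitApp_dual (x : A) : D.unitApp (D.dual x) = D.dualMap (D.unitApp x) := D.unit_dual x

/-- The strict inverse `x°° ⟶ x` of `𝔶_x`. -/
def unitInv (x : A) : D.dual (D.dual x) ⟶ x := D.unit.inv.app x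

@[simp] lemma unitApp_unitInv (x : A) : D.unitApp x ≫ D.unitInv x = 𝟙 x := D.unit.hom_inv_id x

@[simp] lemma unitInv_unitApp (x : A) : D.unitInv x ≫ D.unitApp x = 𝟙 _ := D.unit.inv_hom_id x

end StrongDualityInvolution
end TwoDuality

/-! ### The 2-category of matched pairs. -/

namespace TwoDuality

variable {A : Type u} [Bicategory.{w, v} A] [Bicategory.Strict A] (D : StrongDualityInvolution A)

/-- The objects of the strictification of `D`: an object `x` of `A` and a sign, where `(x, +)`
stands for `x` and `(x, -)` for a formal dual of `x`. The opposite of the sign is stored too, so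
that changing the sign is an involution by definition. -/
structure Strictification (_D : StrongDualityInvolution A) where
  /-- the underlying object of `A` -/
  base : A
  /-- the sign -/
  sign : Bool
  /-- the opposite sign -/
  opSign : Bool
  opSign_eq : opSign = !sign

namespace Strictification

variable {D}

/-- The formal dual. -/
@[simps]
def flip (p : Strictification D) : Strictification D :=
  ⟨p.base, p.opSign, p.sign, by simp [p.opSign_eq]⟩

variable (D) in
/-- `x` or `x°`, according to the sign. -/
def signed (x : A) : Bool → A
  | true => x
  | false => D.dual x

/-- The object of `A` that `p` stands for. -/
def fst (p : Strictification D) : A := signed D p.base p.sign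

/-- The object of `A` that the formal dual of `p` stands for. -/
def snd (p : Strictification D) : A := signed D p.base p.opSign

variable (D) in
/-- The isomorphism from an object to the dual of its formal dual, which is `𝔶` or an identity. -/
def signedUnit (x : A) : ∀ b c : Bool, c = (!b) → (signed D x b ⟶ D.dual (signed D x c))
  | true, false, _ => D.unitApp x
  | false, true, _ => 𝟙 (D.dual x)

variable (D) in
/-- The inverse of `signedUnit`. -/
def signedUnitInv (x : A) : ∀ b c : Bool, c = (!b) → (D.dual (signed D x c) ⟶ signed D x b)
  | true, false, _ => D.unitInv x
  | false, true, _ => 𝟙 (D.dual x)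

lemma signedUnit_comp_inv (x : A) : ∀ (b c : Bool) (h : c = !b),
    signedUnit D x b c h ≫ signedUnitInv D x b c h = 𝟙 _
  | true, false, _ => D.unitApp_unitInv x
  | false, true, _ => Category.comp_id _

lemma signedUnitInv_comp (x : A) : ∀ (b c : Bool) (h : c = !b),
    signedUnitInv D x b c h ≫ signedUnit D x b c h = 𝟙 _
  | true, false, _ => D.unitInv_unitApp x
  | false, true, _ => Category.comp_id _

/-- One factor is `𝔶` or its dual, the other an identity. The negative case needs `𝔶_{x°} = (𝔶_x)°`.
-/
lemma signedUnit_comp_dualMap (x : A) : ∀ (b c : Bool) (h : c = !b) (h' : b = !c),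
    signedUnit D x b c h ≫ D.dualMap (signedUnit D x c b h') = D.unitApp (signed D x b)
  | true, false, _, _ =>
    (congrArg (D.unitApp x ≫ ·) (D.dualMap_id (D.dual x))).trans (Category.comp_id (D.unitApp x))
  | false, true, _, _ => (Category.id_comp (D.dualMap (D.unitApp x))).trans (D.unitApp_dual x).symm

/-- The isomorphism from `p` to the dual of its formal dual. -/
def toDual (p : Strictification D) : p.fst ⟶ D.dual p.snd :=
  signedUnit D p.base p.sign p.opSign p.opSign_eq

/-- The inverse of `toDual`. -/
def ofDual (p : Strictification D) : D.dual p.snd ⟶ p.fst :=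
  signedUnitInv D p.base p.sign p.opSign p.opSign_eq

@[simp] lemma toDual_ofDual (p : Strictification D) : p.toDual ≫ p.ofDual = 𝟙 _ :=
  signedUnit_comp_inv ..

@[simp] lemma ofDual_toDual (p : Strictification D) : p.ofDual ≫ p.toDual = 𝟙 _ :=
  signedUnitInv_comp ..

lemma toDual_dualMap (p : Strictification D) :
    p.toDual ≫ D.dualMap p.flip.toDual = D.unitApp p.fst :=
  signedUnit_comp_dualMap ..

/-- The condition that `f` and the dual of `g` correspond to each other. -/
def Compat₁ (p q : Strictification D) (f : p.fst ⟶ q.fst) (g : p.snd ⟶ q.snd) : Prop :=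
  f ≫ q.toDual = p.toDual ≫ D.dualMap g

/-- The condition that `η` and the dual of `θ` correspond to each other. -/
def Compat₂ (p q : Strictification D) {f f' : p.fst ⟶ q.fst} {g g' : p.snd ⟶ q.snd}
    (η : f ⟶ f') (θ : g' ⟶ g) : Prop :=
  η ▷ q.toDual ≍ p.toDual ◁ D.dualMap₂ θ

section Compat

variable {p q r : Strictification D}

lemma compat₁_id (p : Strictification D) : Compat₁ p p (𝟙 _) (𝟙 _) := by
  simp [Compat₁]

lemma Compat₁.comp {f : p.fst ⟶ q.fst} {g : p.snd ⟶ q.snd} {f' : q.fst ⟶ r.fst}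
    {g' : q.snd ⟶ r.snd} (h : Compat₁ p q f g) (h' : Compat₁ q r f' g') :
    Compat₁ p r (f ≫ f') (g ≫ g') := by
  unfold Compat₁ at *
  rw [Category.assoc, h', ← Category.assoc, h, Category.assoc, D.dualMap_comp]

lemma Compat₂.eqToHom {f f' : p.fst ⟶ q.fst} {g g' : p.snd ⟶ q.snd} (h : Compat₁ p q f g)
    (hf : f = f') (hg : g' = g) : Compat₂ p q (eqToHom hf) (eqToHom hg) := by
  subst hf hg
  simp only [Compat₂, eqToHom_refl, id_whiskerRight, D.dualMap₂_id, whiskerLeft_id]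
  rw [h]

lemma Compat₂.comp {f f' f'' : p.fst ⟶ q.fst} {g g' g'' : p.snd ⟶ q.snd}
    (h : Compat₁ p q f g) (h' : Compat₁ p q f' g') (h'' : Compat₁ p q f'' g'')
    {η : f ⟶ f'} {θ : g' ⟶ g} {η' : f' ⟶ f''} {θ' : g'' ⟶ g'}
    (c : Compat₂ p q η θ) (c' : Compat₂ p q η' θ') : Compat₂ p q (η ≫ η') (θ' ≫ θ) := by
  unfold Compat₂ at *
  rw [comp_whiskerRight, D.dualMap₂_comp, whiskerLeft_comp]
  exact comp_heq_comp h h' h'' c c'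

/-- The compatibility of `η` moves the whiskering 1-cell to `q.toDual`; that of `f` then carries it
to `p.toDual`. -/
lemma Compat₂.whiskerLeft {f : p.fst ⟶ q.fst} {g : p.snd ⟶ q.snd} (h : Compat₁ p q f g)
    {k k' : q.fst ⟶ r.fst} {l l' : q.snd ⟶ r.snd} (h₁ : Compat₁ q r k l)
    (h₂ : Compat₁ q r k' l') {η : k ⟶ k'} {θ : l' ⟶ l} (c : Compat₂ q r η θ) :
    Compat₂ p r (f ◁ η) (g ◁ θ) := by
  unfold Compat₂
  refine (whisker_assoc_heq ..).trans ?_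
  refine (whiskerLeft_heq_whiskerLeft rfl h₁ h₂ c).trans ?_
  refine (comp_whiskerLeft_heq ..).symm.trans ?_
  refine (whiskerLeft_heq_whiskerLeft h rfl rfl HEq.rfl).trans ?_
  refine (comp_whiskerLeft_heq ..).trans ?_
  exact whiskerLeft_heq_whiskerLeft rfl (D.dualMap_comp ..).symm (D.dualMap_comp ..).symm
    (D.dualMap₂_whiskerLeft_heq ..).symm

lemma Compat₂.whiskerRight {f f' : p.fst ⟶ q.fst} {g g' : p.snd ⟶ q.snd}
    (h : Compat₁ p q f g) (h' : Compat₁ p q f' g') {η : f ⟶ f'} {θ : g' ⟶ g}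
    (c : Compat₂ p q η θ) {k : q.fst ⟶ r.fst} {l : q.snd ⟶ r.snd} (h₁ : Compat₁ q r k l) :
    Compat₂ p r (η ▷ k) (θ ▷ l) := by
  unfold Compat₂
  refine (whiskerRight_comp_heq ..).symm.trans ?_
  refine (whiskerRight_heq_whiskerRight rfl rfl h₁ HEq.rfl).trans ?_
  refine (whiskerRight_comp_heq ..).trans ?_
  refine (whiskerRight_heq_whiskerRight h h' rfl c).trans ?_
  refine (whisker_assoc_heq ..).trans ?_
  exact whiskerLeft_heq_whiskerLeft rfl (D.dualMap_comp ..).symm (D.dualMap_comp ..).symm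
    (D.dualMap₂_whiskerRight_heq ..).symm

end Compat

/-- A 1-cell `p ⟶ q` is a 1-cell between the objects that `p` and `q` stand for, together with
its dual. -/
@[ext]
structure Hom₁ (p q : Strictification D) where
  /-- the underlying 1-cell -/
  fst : p.fst ⟶ q.fst
  /-- its dual -/
  snd : p.snd ⟶ q.snd
  -- Each condition implies the other, by `toDual_dualMap` and naturality of `𝔶`. Both are stored so
  -- that dualising is a mere swap.
  compat : Compat₁ p q fst snd
  compat' : Compat₁ p.flip q.flip snd fst

instance : CategoryStruct.{v} (Strictification D) where
  Hom := Hom₁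
  id _ := ⟨𝟙 _, 𝟙 _, compat₁_id _, compat₁_id _⟩
  comp f g := ⟨f.fst ≫ g.fst, f.snd ≫ g.snd, f.compat.comp g.compat, f.compat'.comp g.compat'⟩

@[simp] lemma id_fst (p : Strictification D) : Hom₁.fst (𝟙 p) = 𝟙 p.fst := rfl
@[simp] lemma id_snd (p : Strictification D) : Hom₁.snd (𝟙 p) = 𝟙 p.snd := rfl

section

variable {p q r : Strictification D}

@[simp] lemma comp_fst (f : p ⟶ q) (g : q ⟶ r) : (f ≫ g).fst = f.fst ≫ g.fst := rfl
@[simp] lemma comp_snd (f : p ⟶ q) (g : q ⟶ r) : (f ≫ g).snd = f.snd ≫ g.snd := rfl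

@[ext] lemma hom₁_ext {f g : p ⟶ q} (h : f.fst = g.fst) (h' : f.snd = g.snd) : f = g :=
  Hom₁.ext h h'

/-- A 2-cell is a 2-cell between the underlying 1-cells, together with its dual. -/
@[ext]
structure Hom₂ (f g : p ⟶ q) where
  /-- the underlying 2-cell -/
  fst : f.fst ⟶ g.fst
  /-- its dual -/
  snd : g.snd ⟶ f.snd
  compat : Compat₂ p q fst snd
  compat' : Compat₂ p.flip q.flip snd fst

instance (p q : Strictification D) : Category.{w} (p ⟶ q) where
  Hom f g := Hom₂ f g
  id f := ⟨𝟙 _, 𝟙 _, .eqToHom f.compat rfl rfl, .eqToHom f.compat' rfl rfl⟩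
  comp {f g h} η θ := ⟨η.fst ≫ θ.fst, θ.snd ≫ η.snd,
    .comp f.compat g.compat h.compat η.compat θ.compat,
    .comp h.compat' g.compat' f.compat' θ.compat' η.compat'⟩
  id_comp _ := Hom₂.ext (Category.id_comp _) (Category.comp_id _)
  comp_id _ := Hom₂.ext (Category.comp_id _) (Category.id_comp _)
  assoc _ _ _ := Hom₂.ext (Category.assoc _ _ _) (Category.assoc _ _ _).symm

@[simp] lemma id₂_fst (f : p ⟶ q) : Hom₂.fst (𝟙 f) = 𝟙 f.fst := rfl
@[simp] lemma id₂_snd (f : p ⟶ q) : Hom₂.snd (𝟙 f) = 𝟙 f.snd := rfl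

@[simp] lemma comp₂_fst {f g h : p ⟶ q} (η : f ⟶ g) (θ : g ⟶ h) :
    (η ≫ θ).fst = η.fst ≫ θ.fst := rfl
@[simp] lemma comp₂_snd {f g h : p ⟶ q} (η : f ⟶ g) (θ : g ⟶ h) :
    (η ≫ θ).snd = θ.snd ≫ η.snd := rfl

@[ext] lemma hom₂_ext {f g : p ⟶ q} {η θ : f ⟶ g} (h : η.fst = θ.fst) (h' : η.snd = θ.snd) :
    η = θ :=
  Hom₂.ext h h'

lemma hom₂_heq {f g f' g' : p ⟶ q} {η : f ⟶ g} {θ : f' ⟶ g'} (hf : f = f') (hg : g = g')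
    (h : η.fst ≍ θ.fst) (h' : η.snd ≍ θ.snd) : η ≍ θ := by
  subst hf hg
  exact heq_of_eq (hom₂_ext (eq_of_heq h) (eq_of_heq h'))

@[simp] lemma eqToHom_fst {f g : p ⟶ q} (h : f = g) :
    (eqToHom h).fst = eqToHom (congrArg Hom₁.fst h) := by
  subst h; rfl
@[simp] lemma eqToHom_snd {f g : p ⟶ q} (h : f = g) :
    (eqToHom h).snd = eqToHom (congrArg Hom₁.snd h.symm) := by
  subst h; rfl

end

instance : Bicategory.{w, v} (Strictification D) where
  homCategory p q := inferInstance
  whiskerLeft f g h η := ⟨f.fst ◁ η.fst, f.snd ◁ η.snd,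
    .whiskerLeft f.compat g.compat h.compat η.compat,
    .whiskerLeft f.compat' h.compat' g.compat' η.compat'⟩
  whiskerRight {_ _ _ f g} η h := ⟨η.fst ▷ h.fst, η.snd ▷ h.snd,
    .whiskerRight f.compat g.compat η.compat h.compat,
    .whiskerRight g.compat' f.compat' η.compat' h.compat'⟩
  -- Composition is entrywise, hence strict as in `A`. With `eqToIso` as structure isomorphisms, no
  -- compatibility has to be checked for them and the strictness laws hold by `rfl`.
  associator f g h := eqToIso (by ext <;> simp)
  leftUnitor f := eqToIso (by ext <;> simp)
  rightUnitor f := eqToIso (by ext <;> simp)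
  whiskerLeft_id f g := by ext <;> simp
  whiskerLeft_comp f _ _ _ η θ := by ext <;> simp
  id_whiskerLeft η := by ext <;> simp [Bicategory.Strict.leftUnitor_eqToIso]
  comp_whiskerLeft f g _ _ η := by ext <;> simp [Bicategory.Strict.associator_eqToIso]
  id_whiskerRight f g := by ext <;> simp
  comp_whiskerRight η θ i := by ext <;> simp
  whiskerRight_id η := by ext <;> simp [Bicategory.Strict.rightUnitor_eqToIso]
  whiskerRight_comp η g h := by ext <;> simp [Bicategory.Strict.associator_eqToIso]
  whisker_assoc f _ _ η h := by ext <;> simp [Bicategory.Strict.associator_eqToIso]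
  whisker_exchange η θ := by ext <;> simp [whisker_exchange]
  pentagon f g h i := by ext <;> simp
  triangle f g := by ext <;> simp

section

variable {p q r : Strictification D}

@[simp] lemma whiskerLeft_fst (f : p ⟶ q) {g h : q ⟶ r} (η : g ⟶ h) :
    (f ◁ η).fst = f.fst ◁ η.fst := rfl
@[simp] lemma whiskerLeft_snd (f : p ⟶ q) {g h : q ⟶ r} (η : g ⟶ h) :
    (f ◁ η).snd = f.snd ◁ η.snd := rfl
@[simp] lemma whiskerRight_fst {f g : p ⟶ q} (η : f ⟶ g) (h : q ⟶ r) :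
    (η ▷ h).fst = η.fst ▷ h.fst := rfl
@[simp] lemma whiskerRight_snd {f g : p ⟶ q} (η : f ⟶ g) (h : q ⟶ r) :
    (η ▷ h).snd = η.snd ▷ h.snd := rfl

end

instance : Bicategory.Strict (Strictification D) where
  id_comp f := by ext <;> simp
  comp_id f := by ext <;> simp
  assoc f g h := by ext <;> simp
  leftUnitor_eqToIso _ := rfl
  rightUnitor_eqToIso _ := rfl
  associator_eqToIso _ _ _ := rfl

end Strictification
end TwoDuality

/-! ### The strict involution on matched pairs. -/

namespace TwoDuality.Strictification

variable {A : Type u} [Bicategory.{w, v} A] [Bicategory.Strict A] {D : StrongDualityInvolution A}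

/-- The dual of a 1-cell. -/
def Hom₁.flip {p q : Strictification D} (f : p ⟶ q) : p.flip ⟶ q.flip :=
  ⟨f.snd, f.fst, f.compat', f.compat⟩

/-- The dual of a 2-cell. -/
def Hom₂.flip {p q : Strictification D} {f g : p ⟶ q} (η : f ⟶ g) :
    Hom₁.flip g ⟶ Hom₁.flip f :=
  ⟨η.snd, η.fst, η.compat', η.compat⟩

variable (D) in
/-- The duality 2-functor of the strictification. -/
def flipFunctor : StrictPseudofunctor (Co (Strictification D)) (Strictification D) :=
  StrictPseudofunctor.mk''
    { obj := fun p => p.as.flip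
      map := fun f => Hom₁.flip f.as
      map₂ := fun η => Hom₂.flip η.as
      map₂_whisker_left := fun _ _ _ _ => eq_eqToHom_comp_of_heq rfl rfl HEq.rfl
      map₂_whisker_right := fun _ _ => eq_eqToHom_comp_of_heq rfl rfl HEq.rfl }

variable (D) in
/-- The strict duality involution of the strictification. -/
def involution : StrongDualityInvolution (Strictification D) where
  functor := flipFunctor D
  unit := TwoNatIso.ofComponents
    -- This typechecks because `p.flip.flip` is `p` by definition, both signs being stored.
    (TwoNatTrans.ofHEq (fun p => 𝟙 p)
      (fun f => (Category.comp_id f).trans (Category.id_comp f).symm)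
      (fun η => (whiskerRight_id_heq η).trans (id_whiskerLeft_heq η).symm))
    (fun p => 𝟙 p) (fun p => Category.id_comp (𝟙 p)) (fun p => Category.id_comp (𝟙 p))
  unit_dual _ := rfl

lemma involution_isStrict : (involution D).IsStrict := fun _ => ⟨rfl, rfl⟩

/-! ### The 2-equivalence with `A`. -/

variable (D) in
/-- An object of `A`, with positive sign. -/
@[simps]
def pos (x : A) : Strictification D := ⟨x, true, false, rfl⟩

/-- The 1-cell of the strictification given by a 1-cell of `A`. -/
def posMap {x y : A} (f : x ⟶ y) : pos D x ⟶ pos D y where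
  fst := f
  snd := D.dualMap f
  -- At positive objects `toDual` is `𝔶`, so matching is naturality of `𝔶`; at their flips it is an
  -- identity, so `compat'` is trivial.
  compat := D.unitApp_naturality f
  compat' := (Category.comp_id (D.dualMap f)).trans (Category.id_comp (D.dualMap f)).symm

/-- The 2-cell of the strictification given by a 2-cell of `A`. -/
def posMap₂ {x y : A} {f g : x ⟶ y} (η : f ⟶ g) : posMap (D := D) f ⟶ posMap g where
  fst := η
  snd := D.dualMap₂ η
  compat := D.unitApp_naturality₂_heq η
  compat' := (whiskerRight_id_heq (D.dualMap₂ η)).trans (id_whiskerLeft_heq (D.dualMap₂ η)).symm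

variable (D) in
/-- The inclusion of `A` in its strictification. -/
def inclusion : StrictPseudofunctor A (Strictification D) :=
  StrictPseudofunctor.mk''
    { obj := pos D
      map := posMap
      map₂ := posMap₂
      map₂_id := fun f => hom₂_ext rfl (D.dualMap₂_id f)
      map₂_comp := fun η θ => hom₂_ext rfl (D.dualMap₂_comp η θ)
      map_id := fun x => hom₁_ext rfl (D.dualMap_id x)
      map_comp := fun f g => hom₁_ext rfl (D.dualMap_comp f g)
      map₂_whisker_left := fun {_ b c} f {g g'} η =>
        have e (k : b ⟶ c) : posMap (D := D) (f ≫ k) = posMap f ≫ posMap k :=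
          hom₁_ext rfl (D.dualMap_comp f k)
        eq_eqToHom_comp_of_heq (e g) (e g')
          (hom₂_heq (e g) (e g') HEq.rfl (D.dualMap₂_whiskerLeft_heq f η))
      map₂_whisker_right := fun {a b _ f f'} η g =>
        have e (k : a ⟶ b) : posMap (D := D) (k ≫ g) = posMap k ≫ posMap g :=
          hom₁_ext rfl (D.dualMap_comp k g)
        eq_eqToHom_comp_of_heq (e f) (e f')
          (hom₂_heq (e f) (e f') HEq.rfl (D.dualMap₂_whiskerRight_heq η g)) }

variable (D) in
/-- The 2-functor from the strictification to `A`. -/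
def projection : StrictPseudofunctor (Strictification D) A :=
  StrictPseudofunctor.mk''
    { obj := fst
      map := fun f => f.fst
      map₂ := fun η => η.fst }

/-- The component at `p` of the isomorphism from `1` to `inclusion ∘ projection`. -/
def toPos (p : Strictification D) : p ⟶ pos D p.fst where
  fst := 𝟙 p.fst
  -- Forced by `compat'`, since the first entry and `toDual` at the flip of a positive object are
  -- identities.
  snd := p.flip.toDual
  compat := (Category.id_comp (D.unitApp p.fst)).trans p.toDual_dualMap.symm
  compat' := (Category.comp_id p.flip.toDual).trans
    ((congrArg (p.flip.toDual ≫ ·) (D.dualMap_id p.fst)).trans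
      (Category.comp_id p.flip.toDual)).symm

/-- The inverse of `toPos`. -/
def ofPos (p : Strictification D) : pos D p.fst ⟶ p where
  fst := 𝟙 p.fst
  snd := p.flip.ofDual
  compat := by
    have h : D.dualMap p.flip.toDual ≫ D.dualMap p.flip.ofDual = 𝟙 _ := by
      rw [← D.dualMap_comp, toDual_ofDual, D.dualMap_id]
    -- This is `toDual_dualMap` with its invertible second factor cancelled.
    have h' : D.unitApp p.fst ≫ D.dualMap p.flip.ofDual = p.toDual :=
      (congrArg (· ≫ D.dualMap p.flip.ofDual) p.toDual_dualMap.symm).trans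
        ((Category.assoc _ _ _).trans
          ((congrArg (p.toDual ≫ ·) h).trans (Category.comp_id p.toDual)))
    exact (Category.id_comp p.toDual).trans h'.symm
  compat' := p.flip.ofDual_toDual.trans
    ((Category.id_comp (D.dualMap (𝟙 p.fst))).trans (D.dualMap_id p.fst)).symm

lemma toPos_ofPos (p : Strictification D) : toPos p ≫ ofPos p = 𝟙 p :=
  hom₁_ext (Category.id_comp (𝟙 p.fst)) p.flip.toDual_ofDual

lemma ofPos_toPos (p : Strictification D) : ofPos p ≫ toPos p = 𝟙 _ :=
  hom₁_ext (Category.id_comp (𝟙 p.fst)) p.flip.ofDual_toDual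

/-- The first entry only involves identities; the second is the matching condition on `f` itself. -/
lemma toPos_naturality {p q : Strictification D} (f : p ⟶ q) :
    f ≫ toPos q = toPos p ≫ posMap f.fst :=
  hom₁_ext ((Category.comp_id f.fst).trans (Category.id_comp f.fst).symm) f.compat'

variable (D) in
/-- The isomorphism from `1` to `inclusion ∘ projection`. -/
def toPosIso : TwoNatIso (StrictPseudofunctor.id (Strictification D))
    ((projection D).comp (inclusion D)) :=
  TwoNatIso.ofComponents
    (TwoNatTrans.ofHEq toPos toPos_naturality fun {_ _ f g} η =>
      hom₂_heq (toPos_naturality f) (toPos_naturality g)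
        ((whiskerRight_id_heq η.fst).trans (id_whiskerLeft_heq η.fst).symm) η.compat')
    ofPos toPos_ofPos ofPos_toPos

variable (D) in
lemma inclusion_isTwoEquivalence : IsTwoEquivalence (inclusion D) :=
  ⟨projection D,
    -- Including and then projecting gives back each cell of `A` by definition, so identities serve
    -- as components.
    ⟨TwoNatIso.ofComponents
      (TwoNatTrans.ofHEq (fun x => 𝟙 x)
        (fun f => (Category.comp_id f).trans (Category.id_comp f).symm)
        (fun η => (whiskerRight_id_heq η).trans (id_whiskerLeft_heq η).symm))
      (fun x => 𝟙 x) (fun x => Category.id_comp (𝟙 x)) (fun x => Category.id_comp (𝟙 x))⟩,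
    ⟨(toPosIso D).symm⟩⟩

/-! ### The inclusion as a duality 2-functor. -/

variable (D) in
/-- The comparison of the duals in `A` with those in its strictification. -/
def comparison : TwoNatIso ((Co.map (inclusion D)).comp (involution D).functor)
    (D.functor.comp (inclusion D)) :=
  TwoNatIso.ofComponents
    -- The flip of `(x, +)` stands for `x°`, so `toPos` maps it to `(x°, +)`; naturality is that of
    -- `toPos` at dualised cells.
    (TwoNatTrans.ofHEq (fun x => toPos (pos D x.as).flip)
      (fun f => toPos_naturality (Hom₁.flip (posMap (D := D) f.as)))
      (fun η => (toPosIso D).hom.naturality₂_heq (Hom₂.flip (posMap₂ (D := D) η.as))))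
    (fun x => ofPos (pos D x.as).flip) (fun x => toPos_ofPos (pos D x.as).flip)
    (fun x => ofPos_toPos (pos D x.as).flip)

variable (D) in
/-- The inclusion of `A` in its strictification, as a duality 2-functor. -/
def dualityInclusion : DualityTwoFunctor D (involution D) where
  functor := inclusion D
  comparison := comparison D
  comparison_unit x := by
    -- The unit upstairs is an identity. What remains has first entry `𝔶_x` and second entry
    -- `𝔶_{x°}`, which must equal `(𝔶_x)°`: the axiom again.
    refine (Category.id_comp (Hom₁.flip (toPos (pos D x).flip) ≫
      toPos (pos D (D.dual x)).flip)).trans (hom₁_ext ?_ ?_)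
    · exact Category.comp_id (D.unitApp x)
    · exact (Category.id_comp (D.unitApp (D.dual x))).trans (D.unitApp_dual x)

end TwoDuality.Strictification

theorem mainTheorem2 (A : Type u) [Bicategory.{w, v} A] [Bicategory.Strict A]
    (D : StrongDualityInvolution A) :
    ∃ (A' : Type u) (_ : Bicategory.{w, v} A') (_ : Bicategory.Strict A')
      (D' : StrongDualityInvolution A'),
      D'.IsStrict ∧ ∃ F : DualityTwoFunctor D D', IsTwoEquivalence F.functor :=
  ⟨Strictification D, inferInstance, inferInstance, Strictification.involution D,
    Strictification.involution_isStrict, Strictification.dualityInclusion D,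
    Strictification.inclusion_isTwoEquivalence D⟩
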